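/- Let $m\le p<n$, $A\in\mathbb R^{n\times n}$, $B\in\mathbb R^{n\times m}$, $C\in\mathbb R^{p\times n}$, and consider the plant $\dot x=Ax+B(u+f)$, $y=Cx$, with switching function $s=Hy$, $H\in\mathbb R^{m\times p}$. Let $M\in\mathbb R^{(n-m)\times n}$ have full rank with $MB=0$, let $P_1=\begin{bmatrix}M\\HC\end{bmatrix}$ and $P_1^{-1}=[\,Q\ \ R\,]$ ($Q$ with $n-m$ columns), and put $\xi=Mx$. Assume that (i) the disturbance $f:[0,\infty)\to\mathbb R^m$ is differentiable, and $\|f\|\le F$ and $\|\dot f\|\le V$ on $[0,\infty)$; (ii) $H$ has full rank, $HCB$ is invertible, and the reduced order motion $\dot\xi=MAQ\,\xi$ on $s=0$ is stable, i.e. all eigenvalues of $MAQ$ have negative real part. For a sampling period $T>0$ let $\Phi=e^{AT}$, $\Gamma=\int_0^Te^{A\tau}d\tau\,B$, $\bar A=(\Phi-I)/T$, $\bar B=\Gamma/T$, $\Omega_2=HC\bar AR$ and $d[k]=\int_0^Te^{A\tau}Bf((k+1)T-\tau)\,d\tau$, and consider the sampled-data system $x[k+1]=\Phi x[k]+\Gamma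 u[k]+d[k]$, $s[k]=HCx[k]$, $k\ge 0$, under the output feedback law $$u[k]=-\tfrac1T(HC\bar B)^{-1}\Big(\big((2-\alpha)I_m+T\Omega_2\big)s[k]-\big(I_m+T\Omega_2\big)s[k-1]\Big)+u[k-1],\qquad k\ge1,$$ with an arbitrary first input $u[0]$. The design parameter $\alpha\in(0,1)$ may depend on $T$ and satisfies $(1-\alpha)/T\le\beta_{\max}$ for a constant $\beta_{\max}$ (that is, $\beta=(1-\alpha)/T=O(1)$). Then there is $T^*>0$, depending only on $A,B,C,H,M,\beta_{\max}$, such that $HC\bar B$ is invertible for all $T\in(0,T^*]$, and for all $F,V$: (a) (quasi-sliding motion in an $O(T)$ boundary layer, $O(T)$ ultimate bound on the state) there is a constant $K$, independent of $T$, of $\alpha$, of the initial data and of the particular $f$ satisfying (i), such that for all $T\in(0,T^*]$, all admissible $\alpha$ and all $\rho$ there is $N$ such that $\|x[0]\|\le\rho$ and $\|u[0]\|\le\rho$ imply $\|s[k]\|\le KT$ and $\|x[k]\|\le KT$ for all $k\ge N$; (b) (the control input is $O(1)$) for every $\rho$ there is a constant $K_\rho$, independent of $T\in(0,T^*]$,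 of $\alpha$ and of $f$, such that $\|s[0]\|\le\rho$, $\|\xi[0]\|\le\rho$ and $\|u[0]\|\le\rho$ imply $\|u[k]\|\le K_\rho$ for all $k\ge0$. -/

import Mathlib

open Set Matrix

noncomputable section

/-- The matrices of the plant `ẋ = A x + B (u + f)`, `y = C x`, of the switching function
`s = H y`, and of the upper block `M` of the coordinate change `[M; H C]`.
The state dimension is `n = r + m`, so `r = n - m`; there are `m` inputs and `p` outputs. -/
structure SlidingDesign (r m p : ℕ) where
  A : Matrix (Fin (r + m)) (Fin (r + m)) ℝ
  B : Matrix (Fin (r + m)) (Fin m) ℝ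
  C : Matrix (Fin p) (Fin (r + m)) ℝ
  H : Matrix (Fin m) (Fin p) ℝ
  M : Matrix (Fin r) (Fin (r + m)) ℝ

namespace SlidingDesign

variable {r m p : ℕ} (S : SlidingDesign r m p)

/-- The coordinate change `P₁ = [M; H C]`, as a square matrix. -/
def P₁ : Matrix (Fin (r + m)) (Fin (r + m)) ℝ :=
  (Matrix.fromRows S.M (S.H * S.C)).submatrix finSumFinEquiv.symm id

/-- The first `r = n - m` columns of `P₁⁻¹ = [Q R]`. -/
def Q : Matrix (Fin (r + m)) (Fin r) ℝ := (S.P₁⁻¹).submatrix id (Fin.castAdd m)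

/-- The last `m` columns of `P₁⁻¹ = [Q R]`. -/
def R : Matrix (Fin (r + m)) (Fin m) ℝ := (S.P₁⁻¹).submatrix id (Fin.natAdd r)

/-- The matrix of the reduced order (sliding) motion `ξ̇ = M A Q ξ`. -/
def Ac : Matrix (Fin r) (Fin r) ℝ := S.M * S.A * S.Q

/-- `M` has full row rank and `M B = 0`, that is, the range of `Mᵀ` is the null space of `Bᵀ`. -/
structure IsAnnihilator : Prop where
  mul_eq_zero : S.M * S.B = 0
  rank_eq : S.M.rank = r

/-- `H` has full rank, `H C B` is invertible, and the reduced order motion on the continuous-time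
sliding surface `s = 0` is stable: all eigenvalues of `Ac` have negative real part. -/
structure IsLegitimate : Prop where
  rank_eq : S.H.rank = m
  isUnit_HCB : IsUnit (S.H * S.C * S.B)
  stable : ∀ z ∈ spectrum ℂ (S.Ac.map (algebraMap ℝ ℂ)), z.re < 0

/-- `Φ = exp (T A)`. -/
def Phi (T : ℝ) : Matrix (Fin (r + m)) (Fin (r + m)) ℝ := NormedSpace.exp (T • S.A)

/-- `Γ = (∫₀ᵀ exp (τ A) dτ) B`; the integral is taken entrywise. -/
def Gam (T : ℝ) : Matrix (Fin (r + m)) (Fin m) ℝ :=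
  (Matrix.of fun i j => ∫ τ in (0 : ℝ)..T, (NormedSpace.exp (τ • S.A)) i j) * S.B

/-- The sampled disturbance `d[k] = ∫₀ᵀ exp (τ A) B f((k + 1) T - τ) dτ`. -/
def dist (T : ℝ) (f : ℝ → Fin m → ℝ) (k : ℕ) : Fin (r + m) → ℝ :=
  ∫ τ in (0 : ℝ)..T, (NormedSpace.exp (τ • S.A) * S.B) *ᵥ f (((k : ℝ) + 1) * T - τ)

/-- `Ā = (Φ - I) / T`. -/
def Abar (T : ℝ) : Matrix (Fin (r + m)) (Fin (r + m)) ℝ := (1 / T) • (S.Phi T - 1)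

/-- `B̄ = Γ / T`. -/
def Bbar (T : ℝ) : Matrix (Fin (r + m)) (Fin m) ℝ := (1 / T) • S.Gam T

/-- `H C B̄`. -/
def HCBbar (T : ℝ) : Matrix (Fin m) (Fin m) ℝ := S.H * S.C * S.Bbar T

/-- `Ω₂ = H C Ā R`. -/
def Om2 (T : ℝ) : Matrix (Fin m) (Fin m) ℝ := S.H * S.C * S.Abar T * S.R

/-- The value `s = H C x` of the switching function at the state `x`. -/
def slide (x : Fin (r + m) → ℝ) : Fin m → ℝ := S.H *ᵥ (S.C *ᵥ x)

/-- The remaining coordinates `ξ = M x` of the state `x`. -/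
def xi (x : Fin (r + m) → ℝ) : Fin r → ℝ := S.M *ᵥ x

/-- `(x[k], u[k])` is a closed-loop trajectory: `x` solves the sampled plant
`x[k+1] = Φ x[k] + Γ u[k] + d[k]`, and from the second sample on `u` is given by the output
feedback law
`u[k] = -(1/T) (H C B̄)⁻¹ (((2 - α) I + T Ω₂) s[k] - (I + T Ω₂) s[k-1]) + u[k-1]`, `k ≥ 1`.
The law needs one past sample, so the first input `u[0]` is a free initial value. -/
structure IsClosedLoop (T α : ℝ) (f : ℝ → Fin m → ℝ)
    (x : ℕ → Fin (r + m) → ℝ) (u : ℕ → Fin m → ℝ) : Prop where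
  plant : ∀ k, x (k + 1) = S.Phi T *ᵥ x k + S.Gam T *ᵥ u k + S.dist T f k
  law : ∀ k, u (k + 1) =
    -((1 / T) • ((S.HCBbar T)⁻¹ *ᵥ
        (((2 - α) • (1 : Matrix (Fin m) (Fin m) ℝ) + T • S.Om2 T) *ᵥ S.slide (x (k + 1))
          - ((1 : Matrix (Fin m) (Fin m) ℝ) + T • S.Om2 T) *ᵥ S.slide (x k))))
      + u k

end SlidingDesign

/-- The disturbance `f`, on `[0, ∞)`, is bounded by `F` and differentiable with derivative
bounded by `V` (one-sided derivative at `0`). -/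
structure BoundedDisturbance {m : ℕ} (F V : ℝ) (f : ℝ → Fin m → ℝ) : Prop where
  differentiableOn : DifferentiableOn ℝ f (Ici 0)
  bound : ∀ t, 0 ≤ t → ‖f t‖ ≤ F
  deriv_bound : ∀ t, 0 ≤ t → ‖derivWithin f (Ici 0) t‖ ≤ V

end

/-!
With `D = H C`, `s = D x`, `ξ = M x` and `x = Q ξ + R s`, the sampled plant reads
`s[k+1] = s + T Ω₂ s + T D B̄ u + w` and
`ξ[k+1] = (1 + T M Ā Q) ξ + T M Ā R s + T M B̄ u + M d`,
where `w = T D Ā Q ξ + D d`.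

The feedback law turns the first equation into `s[k+2] = α s[k+1] + w[k+1] - w[k]`
(`IsClosedLoop.slide_succ_succ`). Since `1 - α` has no lower bound, the increments of `w` must not be
summed in norm; instead `σ[k] = s[k+1] - w[k]` satisfies `σ[k+1] = α σ[k] - (1 - α) w[k]`, a convex
combination in norm, so that `σ` is eventually bounded by `sup ‖w‖ = O(T) (sup ‖ξ‖ + F)` whatever
`α` is.

In the second equation the input is eliminated through the first one. Because `M B = 0`, both
`M B̄` and `M d / T` are `O(T)` (`exists_norm_Bbar_sub_le`, `exists_dist_le`), so that `ξ` is driven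
by `T O(‖s‖)` and an `O(T²)` disturbance, while `1 + T M Ā Q` contracts by `1 - c T` in a norm
adapted to the Hurwitz matrix `M A Q` (`exists_adapted_seminorm`, from Gelfand's formula for one
Euler step). The loop `ξ → s → ξ` has gain `O(T)`, and for small `T` a single induction
(`scalar_decay`) bounds both sequences by a geometrically decaying term plus `O(T)`
(`exists_uniform_decay`), with constants independent of `T`, `α` and `f`.

Finally `T D B̄ u[k+1] = -(1 - α) s[k+1] - T Ω₂ s[k+1] - w[k]`, and `1 - α ≤ βmax T` makes the right
side `O(T)`, so the input is `O(1)` (`StepBounds.norm_input_succ_le`).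
-/

open Filter Topology

/-! ### A norm adapted to a Hurwitz matrix -/

section MatrixNorm

attribute [local instance] Matrix.linftyOpNormedAddCommGroup Matrix.linftyOpNormedSpace
  Matrix.linftyOpNormedRing Matrix.linftyOpNormedAlgebra

/-- If the spectrum of `a` lies in the open left half-plane, some short Euler step `1 + τ a`
has its spectrum in the open unit disc. -/
theorem exists_euler_step {r : ℕ} (a : Matrix (Fin r) (Fin r) ℂ)
    (ha : ∀ z ∈ spectrum ℂ a, z.re < 0) :
    ∃ τ : ℝ, 0 < τ ∧ ∀ z ∈ spectrum ℂ (1 + (τ : ℂ) • a), ‖z‖ < 1 := by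
  have key : ∀ᶠ τ : ℝ in 𝓝[>] 0, ∀ z ∈ spectrum ℂ a, ‖1 + (τ : ℂ) * z‖ < 1 := by
    rw [eventually_all_finite a.finite_spectrum]
    intro z hz
    have h1 : ∀ᶠ τ : ℝ in 𝓝[>] 0, 2 * z.re + τ * (z.re ^ 2 + z.im ^ 2) < 0 := by
      have : Tendsto (fun τ : ℝ => 2 * z.re + τ * (z.re ^ 2 + z.im ^ 2)) (𝓝 0)
          (𝓝 (2 * z.re + 0 * (z.re ^ 2 + z.im ^ 2))) := by
        apply Continuous.tendsto (by fun_prop)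
      refine (this.mono_left nhdsWithin_le_nhds).eventually_lt_const ?_
      linarith [ha z hz]
    filter_upwards [h1, self_mem_nhdsWithin] with τ h1 h2
    have h2 : 0 < τ := h2
    have h3 : ‖1 + (τ : ℂ) * z‖ ^ 2 < 1 := by
      rw [← Complex.normSq_eq_norm_sq, Complex.normSq_apply]
      simp
      nlinarith
    nlinarith [norm_nonneg (1 + (τ : ℂ) * z)]
  obtain ⟨τ, h1, h2⟩ := (key.and self_mem_nhdsWithin).exists
  have h2 : 0 < τ := h2
  refine ⟨τ, h2, fun w hw => ?_⟩
  have hτ : (τ : ℂ) ≠ 0 := by exact_mod_cast h2.ne'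
  have hmem : (w - 1) / τ ∈ spectrum ℂ a := by
    rw [spectrum.mem_iff] at hw ⊢
    intro hu
    apply hw
    have : algebraMap ℂ (Matrix (Fin r) (Fin r) ℂ) w - (1 + (τ : ℂ) • a)
        = (Units.mk0 (τ : ℂ) hτ) • (algebraMap ℂ _ ((w - 1) / τ) - a) := by
      simp only [Algebra.algebraMap_eq_smul_one, Units.smul_mk0, smul_sub, smul_smul,
        mul_div_cancel₀ _ hτ, sub_smul, one_smul]
      abel
    rw [this]
    exact hu.smul _
  have := h1 _ hmem
  rwa [mul_div_cancel₀ _ hτ, add_sub_cancel] at this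

theorem norm_map_ofReal {r : ℕ} (a : Matrix (Fin r) (Fin r) ℝ) :
    ‖a.map (algebraMap ℝ ℂ)‖ = ‖a‖ := by
  simp [Matrix.linfty_opNorm_def]

/-- Gelfand's formula: a Hurwitz matrix has an Euler step with a power of norm less than one. -/
theorem exists_pow_euler_step_le {r : ℕ} [NeZero r] (a : Matrix (Fin r) (Fin r) ℝ)
    (ha : ∀ z ∈ spectrum ℂ (a.map (algebraMap ℝ ℂ)), z.re < 0) :
    ∃ τ q : ℝ, ∃ n : ℕ, 0 < τ ∧ 0 < q ∧ q < 1 ∧ n ≠ 0 ∧ ‖(1 + τ • a) ^ n‖ ≤ q ^ n := by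
  obtain ⟨τ, hτ, h⟩ := exists_euler_step _ ha
  have hs : spectralRadius ℂ (1 + (τ : ℂ) • a.map (algebraMap ℝ ℂ)) < (1 : NNReal) :=
    spectrum.spectralRadius_lt_of_forall_lt _ fun z hz => by
      rw [← NNReal.coe_lt_coe]; simpa using h z hz
  obtain ⟨q, hq1, hq2⟩ := ENNReal.lt_iff_exists_nnreal_btwn.mp hs
  have hlim := (spectrum.pow_nnnorm_pow_one_div_tendsto_nhds_spectralRadius
    (1 + (τ : ℂ) • a.map (algebraMap ℝ ℂ))).eventually_lt_const hq1
  obtain ⟨n, hn, hn0⟩ := (hlim.and (eventually_ne_atTop 0)).exists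
  have hq0 : 0 < q := by
    have : (0 : ENNReal) < q := lt_of_le_of_lt bot_le hq1
    exact_mod_cast this
  refine ⟨τ, q, n, hτ, hq0, by exact_mod_cast hq2, hn0, ?_⟩
  have hmap : (1 + (τ : ℂ) • a.map (algebraMap ℝ ℂ)) ^ n
      = ((1 + τ • a) ^ n).map (algebraMap ℝ ℂ) := by
    have h1 : 1 + (τ : ℂ) • a.map (algebraMap ℝ ℂ)
        = (algebraMap ℝ ℂ).mapMatrix (1 + τ • a) := by
      ext i j
      simp [Matrix.one_apply, apply_ite]
    rw [h1, ← map_pow]; rfl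
  rw [hmap] at hn
  have h2 : ‖((1 + τ • a) ^ n).map (algebraMap ℝ ℂ)‖₊ ≤ q ^ n := by
    have h3 : (‖((1 + τ • a) ^ n).map (algebraMap ℝ ℂ)‖₊ : ENNReal) ^ (1 / (n : ℝ)) ≤ q := hn.le
    rw [one_div, ENNReal.rpow_inv_le_iff (by positivity), ENNReal.rpow_natCast] at h3
    exact_mod_cast h3
  rw [← norm_map_ofReal]
  exact_mod_cast h2

/-- A norm adapted to a Hurwitz matrix `a`: for it, every sufficiently short Euler step
`1 + T a` is a contraction, with a factor `1 - c T`. -/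
theorem exists_adapted_seminorm {r : ℕ} [NeZero r] (a : Matrix (Fin r) (Fin r) ℝ)
    (ha : ∀ z ∈ spectrum ℂ (a.map (algebraMap ℝ ℂ)), z.re < 0) :
    ∃ (N : Seminorm ℝ (Fin r → ℝ)) (c τ L : ℝ), 0 < c ∧ 0 < τ ∧ 0 < L ∧
      (∀ v, ‖v‖ ≤ N v) ∧ (∀ v, N v ≤ L * ‖v‖) ∧
      ∀ T, 0 ≤ T → T ≤ τ → ∀ v, N (v + T • a *ᵥ v) ≤ (1 - c * T) * N v := by
  obtain ⟨τ, q, n, hτ, hq0, hq1, hn0, hb⟩ := exists_pow_euler_step_le a ha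
  set b := 1 + τ • a with hbdef
  -- the weighted sum over the orbit up to time `n`; applying `b` shifts the orbit by one
  let N : Seminorm ℝ (Fin r → ℝ) :=
    Seminorm.of (fun v => ∑ j ∈ Finset.range n, q⁻¹ ^ j * ‖(b ^ j) *ᵥ v‖)
      (fun v w => by
        rw [← Finset.sum_add_distrib]
        refine Finset.sum_le_sum fun j _ => ?_
        rw [Matrix.mulVec_add, ← mul_add]
        exact mul_le_mul_of_nonneg_left (norm_add_le _ _) (by positivity))
      (fun t v => by
        rw [Finset.mul_sum]
        refine Finset.sum_congr rfl fun j _ => ?_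
        rw [Matrix.mulVec_smul, norm_smul]
        ring)
  have hN : ∀ v, N v = ∑ j ∈ Finset.range n, q⁻¹ ^ j * ‖(b ^ j) *ᵥ v‖ := fun _ => rfl
  have hbN : ∀ v, N (b *ᵥ v) ≤ q * N v := by
    intro v
    have h1 : N (b *ᵥ v) = q * ∑ j ∈ Finset.range n, q⁻¹ ^ (j + 1) * ‖(b ^ (j + 1)) *ᵥ v‖ := by
      rw [hN, Finset.mul_sum]
      refine Finset.sum_congr rfl fun j _ => ?_
      rw [Matrix.mulVec_mulVec, ← pow_succ, pow_succ q⁻¹]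
      field_simp
    have h2 : q⁻¹ ^ n * ‖(b ^ n) *ᵥ v‖ ≤ ‖v‖ := by
      have := (Matrix.linfty_opNorm_mulVec (b ^ n) v).trans
        (mul_le_mul_of_nonneg_right hb (norm_nonneg v))
      rw [inv_pow, inv_mul_le_iff₀ (by positivity)]
      exact this
    have h3 := Finset.sum_range_succ (fun j => q⁻¹ ^ j * ‖(b ^ j) *ᵥ v‖) n
    rw [Finset.sum_range_succ'] at h3
    simp only [pow_zero, Matrix.one_mulVec, one_mul] at h3
    rw [h1, hN]
    apply mul_le_mul_of_nonneg_left _ hq0.le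
    linarith
  have hL0 : 0 ≤ ∑ j ∈ Finset.range n, q⁻¹ ^ j * ‖b ^ j‖ :=
    Finset.sum_nonneg fun j _ => by positivity
  refine ⟨N, (1 - q) / τ, τ, ∑ j ∈ Finset.range n, q⁻¹ ^ j * ‖b ^ j‖ + 1, by
    apply div_pos <;> linarith, hτ, by linarith, fun v => ?_, fun v => ?_, fun T hT0 hT v => ?_⟩
  · rw [hN]
    have := Finset.single_le_sum (f := fun j => q⁻¹ ^ j * ‖(b ^ j) *ᵥ v‖)
      (fun j _ => by positivity) (Finset.mem_range.mpr (Nat.pos_of_ne_zero hn0))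
    simpa using this
  · rw [hN, add_mul, Finset.sum_mul]
    have : ∑ j ∈ Finset.range n, q⁻¹ ^ j * ‖(b ^ j) *ᵥ v‖
        ≤ ∑ j ∈ Finset.range n, q⁻¹ ^ j * ‖b ^ j‖ * ‖v‖ := by
      refine Finset.sum_le_sum fun j _ => ?_
      rw [mul_assoc]
      exact mul_le_mul_of_nonneg_left (Matrix.linfty_opNorm_mulVec _ _) (by positivity)
    linarith [norm_nonneg v]
  · -- a shorter Euler step is a convex combination of the identity and of `b`
    have h1 : v + T • a *ᵥ v = (1 - T / τ) • v + (T / τ) • (b *ᵥ v) := by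
      rw [hbdef, Matrix.add_mulVec, Matrix.one_mulVec, Matrix.smul_mulVec, smul_add, smul_smul,
        div_mul_cancel₀ _ hτ.ne', sub_smul, one_smul]
      abel
    have h2 : 0 ≤ T / τ := by positivity
    have h3 : T / τ ≤ 1 := (div_le_one hτ).mpr hT
    calc N (v + T • a *ᵥ v) ≤ (1 - T / τ) * N v + (T / τ) * N (b *ᵥ v) := by
          rw [h1]
          refine (map_add_le_add N _ _).trans_eq ?_
          rw [map_smul_eq_mul, map_smul_eq_mul, Real.norm_of_nonneg h2,
            Real.norm_of_nonneg (by linarith)]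
      _ ≤ (1 - T / τ) * N v + (T / τ) * (q * N v) := by
          gcongr
          exact hbN v
      _ = _ := by field_simp; ring

end MatrixNorm

/-! ### The scalar small-gain estimate -/

/-- Here `z` stands for the norm of `ξ`, `S` for that of `s`, and `P k` for that of `s[k+1] - w[k]`.
With `E k = l ^ k X + K T`, the bounds `z ≤ E`, `P ≤ a E`, `S ≤ 5 a E` reproduce themselves: `a` is
small enough for the feedthrough of `S` to use up only half of the contraction `c T` of `z`, and then
`T` is small enough for the gain `T e` from `z` to `P` to be at most `a / 4`. The rate `l` may tend
to `1` with `α`, but `a` does not depend on `α`. -/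
theorem scalar_decay {c e : ℝ} (hc : 0 < c) (he : 0 ≤ e) :
    ∃ a : ℝ, 0 < a ∧ ∀ g K T α X : ℝ, 0 ≤ g → 4 * g ≤ a * K → 0 < T → 4 * (T * e) ≤ a →
      c * T ≤ 1 → 0 < α → α < 1 → 0 ≤ X →
      ∃ l : ℝ, 0 ≤ l ∧ l < 1 ∧ ∀ z P S : ℕ → ℝ,
        z 0 ≤ X → P 0 ≤ a * X → S 0 ≤ 5 * a * X →
        (∀ k, z (k + 1) ≤ (1 - c * T) * z k + T * (e * (S (k + 1) + S k)) + T * (T * g)) →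
        (∀ k, S (k + 1) ≤ P k + (T * e * z k + T * g)) →
        (∀ k, P (k + 1) ≤ α * P k + (1 - α) * (T * e * z k + T * g)) →
        ∀ k, z k ≤ l ^ k * X + K * T ∧ S k ≤ 5 * a * (l ^ k * X + K * T) := by
  have hden : 0 < 20 * e + 1 := by linarith
  refine ⟨c / (20 * e + 1), by positivity, ?_⟩
  set a := c / (20 * e + 1) with ha
  have ha0 : 0 < a := by positivity
  have hac : 10 * e * a + a / 4 ≤ c / 2 := by
    have : a * (20 * e + 1) = c := by rw [ha]; field_simp
    linarith
  intro g K T α X hg hgK hT hTe hcT hα0 hα1 hX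
  have hK : 0 ≤ K := by
    by_contra h
    have := mul_neg_of_pos_of_neg ha0 (not_le.mp h)
    linarith
  -- `1 / 2 ≤ l` keeps `E k ≤ 2 E (k + 1)`; the other two are half of the available contractions
  let l := max (1 / 2) (max (1 - (1 - α) / 2) (1 - c * T / 2))
  have hl1 : 1 / 2 ≤ l := le_max_left _ _
  have hl2 : 1 - (1 - α) / 2 ≤ l := (le_max_left _ _).trans (le_max_right _ _)
  have hl3 : 1 - c * T / 2 ≤ l := (le_max_right _ _).trans (le_max_right _ _)
  have hcT0 : 0 < c * T := by positivity
  have hl : l < 1 := max_lt (by norm_num) (max_lt (by linarith) (by linarith))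
  refine ⟨l, by linarith, hl, fun z P S hz0 hP0 hS0 hz hS hP => ?_⟩
  let E : ℕ → ℝ := fun k => l ^ k * X + K * T
  have hKT : 0 ≤ K * T := by positivity
  have hlX : ∀ k, 0 ≤ l ^ k * X := fun k => by
    have : 0 ≤ l := by linarith
    positivity
  have hKE : ∀ k, K * T ≤ E k := fun k => by simp only [E]; linarith [hlX k]
  have hE : ∀ k, l * E k ≤ E (k + 1) := fun k => by
    simp only [E, pow_succ]
    nlinarith
  have hEanti : ∀ k, E (k + 1) ≤ E k := fun k => by
    simp only [E, pow_succ]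
    nlinarith [hlX k]
  have hgE : ∀ k, 4 * (T * g) ≤ a * E k := fun k => by
    have := mul_le_mul_of_nonneg_left (hKE k) ha0.le
    nlinarith
  have main : ∀ k, z k ≤ E k ∧ P k ≤ a * E k ∧ S k ≤ 5 * a * E k := by
    intro k
    induction k with
    | zero =>
      simp only [E, pow_zero, one_mul]
      have := mul_nonneg ha0.le hKT
      refine ⟨by linarith, by linarith, by linarith⟩
    | succ k ih =>
      obtain ⟨iz, iP, iS⟩ := ih
      have hE0 : 0 ≤ E k := hKT.trans (hKE k)
      have hw : T * e * z k + T * g ≤ a * E k / 2 := by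
        have h1 : T * e * z k ≤ T * e * E k := mul_le_mul_of_nonneg_left iz (by positivity)
        have h2 : 4 * (T * e) * E k ≤ a * E k := mul_le_mul_of_nonneg_right hTe hE0
        linarith [hgE k]
      have hl' : ∀ x, x ≤ l → x * E k ≤ E (k + 1) := fun x hx =>
        (mul_le_mul_of_nonneg_right hx hE0).trans (hE k)
      have hS1 : S (k + 1) ≤ 5 * a * E (k + 1) := by
        have := mul_le_mul_of_nonneg_left (hl' _ hl1) ha0.le
        have := mul_nonneg ha0.le hE0
        linarith [hS k]
      refine ⟨?_, ?_, hS1⟩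
      · have h1 : (1 - c * T) * z k ≤ (1 - c * T) * E k :=
          mul_le_mul_of_nonneg_left iz (by linarith)
        have h2 : e * (S (k + 1) + S k) ≤ e * (10 * a * E k) := by
          apply mul_le_mul_of_nonneg_left _ he
          have := mul_le_mul_of_nonneg_left (hEanti k) ha0.le
          linarith
        have h3 : e * (S (k + 1) + S k) + T * g ≤ c / 2 * E k := by
          have := mul_le_mul_of_nonneg_right hac hE0
          linarith [hgE k]
        have h4 := mul_le_mul_of_nonneg_left h3 hT.le
        have := hl' _ hl3
        linarith [hz k]
      · have h1 : α * P k ≤ α * (a * E k) := mul_le_mul_of_nonneg_left iP hα0.le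
        have h2 := mul_le_mul_of_nonneg_left hw (by linarith : 0 ≤ 1 - α)
        have := mul_le_mul_of_nonneg_left (hl' _ hl2) ha0.le
        linarith [hP k]
  exact fun k => ⟨(main k).1, (main k).2.2⟩

/-! ### The sampled plant as the period tends to zero -/

section Sampling

attribute [local instance] Matrix.linftyOpNormedAddCommGroup Matrix.linftyOpNormedSpace
  Matrix.linftyOpNormedRing Matrix.linftyOpNormedAlgebra

theorem norm_entry_le {ι κ : Type*} [Fintype ι] [Fintype κ] (M : Matrix ι κ ℝ) (i : ι) (j : κ) :
    ‖M i j‖ ≤ ‖M‖ := by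
  have h1 : ‖M i j‖₊ ≤ ∑ l, ‖M i l‖₊ :=
    Finset.single_le_sum (f := fun l => ‖M i l‖₊) (fun _ _ => by positivity) (Finset.mem_univ j)
  have h2 : ∑ l, ‖M i l‖₊ ≤ ‖M‖₊ := by
    rw [Matrix.linfty_opNNNorm_def]
    exact Finset.le_sup (f := fun i => ∑ l, ‖M i l‖₊) (Finset.mem_univ i)
  exact_mod_cast h1.trans h2

theorem norm_le_card_mul {ι κ : Type*} [Fintype ι] [Fintype κ] (M : Matrix ι κ ℝ) {b : ℝ}
    (hb : 0 ≤ b) (h : ∀ i j, ‖M i j‖ ≤ b) : ‖M‖ ≤ Fintype.card κ * b := by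
  lift b to NNReal using hb
  rw [Matrix.linfty_opNorm_def]
  have : (Finset.univ.sup fun i => ∑ j, ‖M i j‖₊) ≤ Fintype.card κ * b := by
    refine Finset.sup_le fun i _ => ?_
    refine (Finset.sum_le_card_nsmul _ _ b fun j _ => ?_).trans_eq (by simp)
    exact_mod_cast h i j
  exact_mod_cast this

namespace SlidingDesign

variable {r m p : ℕ} (S : SlidingDesign r m p)

theorem tendsto_Abar : Tendsto S.Abar (𝓝[>] 0) (𝓝 S.A) := by
  have h := (hasDerivAt_exp_smul_const (𝕂 := ℝ) S.A 0).tendsto_slope_zero_right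
  simp only [zero_smul, NormedSpace.exp_zero, one_mul, zero_add] at h
  refine h.congr fun T => ?_
  rw [Abar, Phi, one_div]
  rfl

theorem exists_norm_exp_sub_one_le : ∃ L δ : ℝ, 0 < L ∧ 0 < δ ∧
    ∀ t, 0 ≤ t → t ≤ δ → ‖NormedSpace.exp (t • S.A) - 1‖ ≤ L * t := by
  have h := S.tendsto_Abar.norm.eventually_lt_const (lt_add_one ‖S.A‖)
  obtain ⟨δ, hδ, h⟩ := mem_nhdsGT_iff_exists_Ioc_subset.mp h
  refine ⟨‖S.A‖ + 1, δ, by positivity, hδ, fun t ht0 ht => ?_⟩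
  rcases ht0.eq_or_lt with rfl | ht0
  · simp
  · have h1 : ‖S.Abar t‖ < ‖S.A‖ + 1 := h ⟨ht0, ht⟩
    rw [Abar, norm_smul, Real.norm_of_nonneg (by positivity), one_div, inv_mul_lt_iff₀ ht0,
      mul_comm] at h1
    exact h1.le

theorem continuous_exp_smul : Continuous fun t : ℝ => NormedSpace.exp (t • S.A) :=
  continuous_iff_continuousAt.mpr fun t =>
    (hasDerivAt_exp_smul_const (𝕂 := ℝ) S.A t).continuousAt

theorem exists_norm_Bbar_sub_le : ∃ L δ : ℝ, 0 < L ∧ 0 < δ ∧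
    ∀ T, 0 < T → T ≤ δ → ‖S.Bbar T - S.B‖ ≤ L * T := by
  obtain ⟨L, δ, hL, hδ, h⟩ := S.exists_norm_exp_sub_one_le
  refine ⟨Fintype.card (Fin (r + m)) * L * ‖S.B‖ + 1, δ, by positivity, hδ, fun T hT0 hT => ?_⟩
  set J : Matrix (Fin (r + m)) (Fin (r + m)) ℝ :=
    Matrix.of fun i j => ∫ τ in (0 : ℝ)..T, (NormedSpace.exp (τ • S.A)) i j with hJ
  have hJ1 : ‖J - T • 1‖ ≤ Fintype.card (Fin (r + m)) * (L * T * T) := by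
    refine norm_le_card_mul _ (by positivity) fun i j => ?_
    have hc : Continuous fun τ : ℝ => (NormedSpace.exp (τ • S.A)) i j :=
      S.continuous_exp_smul.matrix_elem i j
    have h1 : (J - T • 1) i j
        = ∫ τ in (0 : ℝ)..T, (NormedSpace.exp (τ • S.A) - 1) i j := by
      simp only [Matrix.sub_apply]
      rw [intervalIntegral.integral_sub (hc.intervalIntegrable _ _) (by simp)]
      simp [hJ]
    rw [h1]
    refine (intervalIntegral.norm_integral_le_of_norm_le_const fun τ hτ => ?_).trans_eq
      (by rw [sub_zero, abs_of_pos hT0])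
    rw [uIoc_of_le hT0.le] at hτ
    refine (norm_entry_le _ i j).trans ((h τ hτ.1.le (hτ.2.trans hT)).trans ?_)
    exact mul_le_mul_of_nonneg_left hτ.2 hL.le
  have h2 : S.Bbar T - S.B = (1 / T) • ((J - T • 1) * S.B) := by
    rw [Bbar, Gam, ← hJ, Matrix.sub_mul, smul_sub, Matrix.smul_mul, Matrix.one_mul, smul_smul,
      one_div_mul_cancel hT0.ne', one_smul]
  rw [h2, norm_smul, Real.norm_of_nonneg (by positivity), one_div, inv_mul_le_iff₀ hT0]
  calc ‖(J - T • 1) * S.B‖ ≤ ‖J - T • 1‖ * ‖S.B‖ := Matrix.linfty_opNorm_mul _ _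
    _ ≤ Fintype.card (Fin (r + m)) * (L * T * T) * ‖S.B‖ := by gcongr
    _ ≤ T * ((Fintype.card (Fin (r + m)) * L * ‖S.B‖ + 1) * T) := by nlinarith [mul_pos hT0 hT0]

theorem tendsto_Bbar : Tendsto S.Bbar (𝓝[>] 0) (𝓝 S.B) := by
  obtain ⟨L, δ, hL, hδ, h⟩ := S.exists_norm_Bbar_sub_le
  refine tendsto_iff_norm_sub_tendsto_zero.mpr ?_
  have h0 : Tendsto (fun T : ℝ => L * T) (𝓝[>] 0) (𝓝 0) := by
    have : Tendsto (fun T : ℝ => L * T) (𝓝 0) (𝓝 (L * 0)) := (continuous_const_mul L).tendsto 0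
    rw [mul_zero] at this
    exact this.mono_left nhdsWithin_le_nhds
  refine squeeze_zero' (Eventually.of_forall fun _ => norm_nonneg _) ?_ h0
  filter_upwards [Ioc_mem_nhdsGT hδ] with T hT using h T hT.1 hT.2

/-- The sampled disturbance is `O(T)`, and its component `M d` along the sliding motion is
`O(T²)`, because `M exp (τ A) B = M (exp (τ A) - 1) B`. -/
theorem exists_dist_le (hMB : S.M * S.B = 0) : ∃ L δ : ℝ, 0 < L ∧ 0 < δ ∧
    ∀ T F V : ℝ, ∀ f : ℝ → Fin m → ℝ, ∀ k, 0 < T → T ≤ δ → BoundedDisturbance F V f →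
      ‖S.dist T f k‖ ≤ L * F * T ∧ ‖S.M *ᵥ S.dist T f k‖ ≤ L * F * T * T := by
  obtain ⟨L, δ, hL, hδ, h⟩ := S.exists_norm_exp_sub_one_le
  set b := ‖(1 : Matrix (Fin (r + m)) (Fin (r + m)) ℝ)‖ with hb
  refine ⟨(L * δ + b) * ‖S.B‖ + ‖S.M‖ * L * ‖S.B‖ + 1, δ, by positivity, hδ,
    fun T F V f k hT0 hT hf => ?_⟩
  have hF : 0 ≤ F := (norm_nonneg _).trans (hf.bound 0 le_rfl)
  have htime : ∀ τ ≤ T, 0 ≤ ((k : ℝ) + 1) * T - τ := fun τ hτ => by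
    have : 0 ≤ (k : ℝ) * T := by positivity
    linarith
  have hX : 0 ≤ (L * δ + b) * ‖S.B‖ * F * T := by positivity
  have hY : 0 ≤ ‖S.M‖ * L * ‖S.B‖ * F * T := by positivity
  have hZ : 0 ≤ F * T := by positivity
  constructor
  · have h1 : ‖S.dist T f k‖ ≤ (L * δ + b) * ‖S.B‖ * F * |T - 0| := by
      refine intervalIntegral.norm_integral_le_of_norm_le_const fun τ hτ => ?_
      rw [uIoc_of_le hT0.le] at hτ
      have he : ‖NormedSpace.exp (τ • S.A)‖ ≤ L * δ + b := by
        have h2 := h τ hτ.1.le (hτ.2.trans hT)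
        have h3 : L * τ ≤ L * δ := mul_le_mul_of_nonneg_left (hτ.2.trans hT) hL.le
        have h4 := norm_sub_norm_le (NormedSpace.exp (τ • S.A)) 1
        linarith
      calc _ ≤ ‖NormedSpace.exp (τ • S.A) * S.B‖ * ‖f (((k : ℝ) + 1) * T - τ)‖ :=
            Matrix.linfty_opNorm_mulVec _ _
        _ ≤ (‖NormedSpace.exp (τ • S.A)‖ * ‖S.B‖) * F := by
            gcongr
            · exact Matrix.linfty_opNorm_mul _ _
            · exact hf.bound _ (htime τ hτ.2)
        _ ≤ _ := by gcongr
    rw [sub_zero, abs_of_pos hT0] at h1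
    linarith
  -- `f` is differentiable, hence continuous, so `M` may be moved under the integral sign
  · have hint : IntervalIntegrable
        (fun τ => (NormedSpace.exp (τ • S.A) * S.B) *ᵥ f (((k : ℝ) + 1) * T - τ))
        MeasureTheory.volume 0 T := by
      apply ContinuousOn.intervalIntegrable
      rw [uIcc_of_le hT0.le]
      have hfc : ContinuousOn (fun τ => f (((k : ℝ) + 1) * T - τ)) (Icc 0 T) :=
        hf.differentiableOn.continuousOn.comp (by fun_prop) fun τ hτ => htime τ hτ.2
      have hE : Continuous fun τ : ℝ => NormedSpace.exp (τ • S.A) * S.B :=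
        S.continuous_exp_smul.matrix_mul continuous_const
      have hm : Continuous fun q : Matrix (Fin (r + m)) (Fin m) ℝ × (Fin m → ℝ) => q.1 *ᵥ q.2 :=
        continuous_fst.matrix_mulVec continuous_snd
      exact hm.comp_continuousOn (hE.continuousOn.prodMk hfc)
    have h1 : S.M *ᵥ S.dist T f k = ∫ τ in (0 : ℝ)..T,
        S.M *ᵥ ((NormedSpace.exp (τ • S.A) * S.B) *ᵥ f (((k : ℝ) + 1) * T - τ)) :=
      ((Matrix.mulVecLin S.M).toContinuousLinearMap.intervalIntegral_comp_comm hint).symm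
    have h2 : ‖S.M *ᵥ S.dist T f k‖ ≤ ‖S.M‖ * (L * T) * ‖S.B‖ * F * |T - 0| := by
      rw [h1]
      refine intervalIntegral.norm_integral_le_of_norm_le_const fun τ hτ => ?_
      rw [uIoc_of_le hT0.le] at hτ
      have h3 : S.M *ᵥ ((NormedSpace.exp (τ • S.A) * S.B) *ᵥ f (((k : ℝ) + 1) * T - τ))
          = (S.M * ((NormedSpace.exp (τ • S.A) - 1) * S.B)) *ᵥ f (((k : ℝ) + 1) * T - τ) := by
        rw [Matrix.mulVec_mulVec, Matrix.sub_mul, Matrix.one_mul, Matrix.mul_sub, hMB, sub_zero]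
      have h4 := h τ hτ.1.le (hτ.2.trans hT)
      rw [h3]
      calc _ ≤ ‖S.M * ((NormedSpace.exp (τ • S.A) - 1) * S.B)‖
              * ‖f (((k : ℝ) + 1) * T - τ)‖ := Matrix.linfty_opNorm_mulVec _ _
        _ ≤ (‖S.M‖ * (‖NormedSpace.exp (τ • S.A) - 1‖ * ‖S.B‖)) * F := by
            gcongr
            · refine (Matrix.linfty_opNorm_mul _ _).trans ?_
              gcongr
              exact Matrix.linfty_opNorm_mul _ _
            · exact hf.bound _ (htime τ hτ.2)
        _ ≤ (‖S.M‖ * ((L * T) * ‖S.B‖)) * F := by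
            gcongr
            exact h4.trans (mul_le_mul_of_nonneg_left hτ.2 hL.le)
        _ = _ := by ring
    rw [sub_zero, abs_of_pos hT0] at h2
    have h5 := mul_nonneg hX hT0.le
    have h6 := mul_nonneg hZ hT0.le
    linarith

/-! ### The coordinates `(ξ, s)` -/

/-- `[M; H C]` is injective: the kernel of `M` is the range of `B`, on which `H C` is injective. -/
theorem isUnit_det_P₁ (hM : S.IsAnnihilator) (hB : IsUnit (S.H * S.C * S.B)) :
    IsUnit S.P₁.det := by
  rw [isUnit_iff_ne_zero]
  intro h0
  obtain ⟨v, hv0, hv⟩ := Matrix.exists_mulVec_eq_zero_iff.mpr h0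
  have hinj : Function.Injective (S.H * S.C * S.B).mulVec :=
    Matrix.mulVec_injective_iff_isUnit.mpr hB
  have hv' : Sum.elim (S.M *ᵥ v) ((S.H * S.C) *ᵥ v) = 0 := by
    rw [← Matrix.fromRows_mulVec]
    funext i
    have := congrFun hv (finSumFinEquiv i)
    rw [P₁] at this
    simpa [Matrix.mulVec, dotProduct] using this
  have hMv : S.M *ᵥ v = 0 := by
    funext i
    exact congrFun hv' (Sum.inl i)
  have hDv : (S.H * S.C) *ᵥ v = 0 := by
    funext i
    exact congrFun hv' (Sum.inr i)
  have hle : LinearMap.range S.B.mulVecLin ≤ LinearMap.ker S.M.mulVecLin := by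
    rintro _ ⟨w, rfl⟩
    simp [Matrix.mulVec_mulVec, hM.mul_eq_zero]
  have hBinj : Function.Injective S.B.mulVecLin := fun w w' h => hinj <| by
    have h : S.B *ᵥ w = S.B *ᵥ w' := h
    simp only [← Matrix.mulVec_mulVec, h]
  have hrange : Module.finrank ℝ (LinearMap.range S.B.mulVecLin) = m := by
    rw [LinearMap.finrank_range_of_inj hBinj]; simp
  have hker : Module.finrank ℝ (LinearMap.ker S.M.mulVecLin) = m := by
    have h1 := S.M.mulVecLin.finrank_range_add_finrank_ker
    have h2 : Module.finrank ℝ (LinearMap.range S.M.mulVecLin) = r := hM.rank_eq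
    rw [h2] at h1
    simpa using h1
  have heq := Submodule.eq_of_le_of_finrank_eq hle (hrange.trans hker.symm)
  have hvk : v ∈ LinearMap.range S.B.mulVecLin := by
    rw [heq]; exact hMv
  obtain ⟨w, rfl⟩ := hvk
  apply hv0
  have : w = 0 := hinj (by
    rw [Matrix.mulVec_zero, ← Matrix.mulVec_mulVec]; exact hDv)
  rw [this, map_zero]

theorem eq_Q_mulVec_add (h : IsUnit S.P₁.det) (x : Fin (r + m) → ℝ) :
    x = S.Q *ᵥ S.xi x + S.R *ᵥ S.slide x := by
  have h1 : x = S.P₁⁻¹ *ᵥ (S.P₁ *ᵥ x) := by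
    rw [Matrix.mulVec_mulVec, Matrix.nonsing_inv_mul _ h, Matrix.one_mulVec]
  have h2 : ∀ i, (S.P₁ *ᵥ x) (Fin.castAdd m i) = S.xi x i := fun i => by
    simp [P₁, xi, Matrix.mulVec, dotProduct, Matrix.fromRows_apply_inl]
  have h3 : ∀ i, (S.P₁ *ᵥ x) (Fin.natAdd r i) = S.slide x i := fun i => by
    rw [slide, Matrix.mulVec_mulVec]
    simp [P₁, Matrix.mulVec, dotProduct, Matrix.fromRows_apply_inr]
  conv_lhs => rw [h1]
  funext i
  rw [Matrix.mulVec, dotProduct, Fin.sum_univ_add]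
  simp only [h2, h3]
  rfl

end SlidingDesign

end Sampling

/-! ### Estimates for small sampling periods -/

namespace SlidingDesign

variable {r m p : ℕ} (S : SlidingDesign r m p)

/-- The estimates on the sampled plant with period `T` that the closed-loop analysis uses:
`L` bounds all coefficient matrices, and the adapted seminorm `N` contracts by `1 - c T` along the
sampled reduced order motion. -/
structure StepBounds (N : Seminorm ℝ (Fin r → ℝ)) (c L T : ℝ) : Prop where
  isUnit : IsUnit (S.HCBbar T)
  contract : ∀ v, N (v + T • (S.M * S.Abar T * S.Q) *ᵥ v) ≤ (1 - c * T) * N v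
  norm_le : ∀ v, ‖v‖ ≤ N v
  le_norm : ∀ v, N v ≤ L * ‖v‖
  MAR : ∀ v, ‖(S.M * S.Abar T * S.R) *ᵥ v‖ ≤ L * ‖v‖
  HCAQ : ∀ v, ‖(S.H * S.C * S.Abar T * S.Q) *ᵥ v‖ ≤ L * ‖v‖
  Om2 : ∀ v, ‖S.Om2 T *ᵥ v‖ ≤ L * ‖v‖
  HCBbar : ∀ v, ‖S.HCBbar T *ᵥ v‖ ≤ L * ‖v‖
  HCBbar_inv : ∀ v, ‖(S.HCBbar T)⁻¹ *ᵥ v‖ ≤ L * ‖v‖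
  MBbar : ∀ v, ‖(S.M * S.Bbar T) *ᵥ v‖ ≤ L * T * ‖v‖
  slide : ∀ x, ‖S.slide x‖ ≤ L * ‖x‖
  xi : ∀ x, ‖S.xi x‖ ≤ L * ‖x‖
  Q : ∀ v, ‖S.Q *ᵥ v‖ ≤ L * ‖v‖
  R : ∀ v, ‖S.R *ᵥ v‖ ≤ L * ‖v‖
  slide_dist : ∀ F V f k, BoundedDisturbance F V f → ‖S.slide (S.dist T f k)‖ ≤ L * F * T
  xi_dist : ∀ F V f k, BoundedDisturbance F V f → ‖S.xi (S.dist T f k)‖ ≤ L * F * T * T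

section Bounds

attribute [local instance] Matrix.linftyOpNormedAddCommGroup Matrix.linftyOpNormedSpace
  Matrix.linftyOpNormedRing Matrix.linftyOpNormedAlgebra

/-- Quantifying over all large `L` lets finitely many such bounds share one constant. -/
theorem eventually_mulVec_le {ι κ : Type*} [Fintype ι] [Fintype κ]
    {g : ℝ → Matrix ι κ ℝ} {G : Matrix ι κ ℝ} (h : Tendsto g (𝓝[>] 0) (𝓝 G)) :
    ∀ᶠ L in atTop, ∀ᶠ T in 𝓝[>] 0, ∀ v, ‖g T *ᵥ v‖ ≤ L * ‖v‖ := by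
  filter_upwards [eventually_gt_atTop ‖G‖] with L hL
  filter_upwards [h.norm.eventually_lt_const hL] with T hT v
  exact (Matrix.linfty_opNorm_mulVec _ _).trans (mul_le_mul_of_nonneg_right hT.le (norm_nonneg v))

theorem eventually_mulVec_const_le {ι κ : Type*} [Fintype ι] [Fintype κ] (G : Matrix ι κ ℝ) :
    ∀ᶠ L in atTop, ∀ v, ‖G *ᵥ v‖ ≤ L * ‖v‖ := by
  filter_upwards [eventually_ge_atTop ‖G‖] with L hL v
  exact (Matrix.linfty_opNorm_mulVec _ _).trans (mul_le_mul_of_nonneg_right hL (norm_nonneg v))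

theorem exists_stepBounds [NeZero r] (hM : S.IsAnnihilator) (hS : S.IsLegitimate) :
    ∃ (N : Seminorm ℝ (Fin r → ℝ)) (c L δ : ℝ), 0 < c ∧ 1 ≤ L ∧ 0 < δ ∧
      ∀ T, 0 < T → T ≤ δ → S.StepBounds N c L T := by
  obtain ⟨N, c, τ, L₀, hc, hτ, hL₀, hN1, hN2, hN⟩ := exists_adapted_seminorm S.Ac hS.stable
  obtain ⟨L₁, δ₁, -, hδ₁, hB⟩ := S.exists_norm_Bbar_sub_le
  obtain ⟨L₂, δ₂, hL₂, hδ₂, hd⟩ := S.exists_dist_le hM.mul_eq_zero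
  have hA := S.tendsto_Abar
  have hMA : Tendsto (fun T => S.M * S.Abar T) (𝓝[>] 0) (𝓝 (S.M * S.A)) :=
    ((continuous_const.matrix_mul continuous_id).tendsto S.A).comp hA
  have hDA : Tendsto (fun T => S.H * S.C * S.Abar T) (𝓝[>] 0) (𝓝 (S.H * S.C * S.A)) :=
    ((continuous_const.matrix_mul continuous_id).tendsto S.A).comp hA
  have hMAQ : Tendsto (fun T => S.M * S.Abar T * S.Q) (𝓝[>] 0) (𝓝 S.Ac) :=
    ((continuous_id.matrix_mul continuous_const).tendsto _).comp hMA
  have hMAR : Tendsto (fun T => S.M * S.Abar T * S.R) (𝓝[>] 0) (𝓝 (S.M * S.A * S.R)) :=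
    ((continuous_id.matrix_mul continuous_const).tendsto _).comp hMA
  have hDAQ : Tendsto (fun T => S.H * S.C * S.Abar T * S.Q) (𝓝[>] 0)
      (𝓝 (S.H * S.C * S.A * S.Q)) :=
    ((continuous_id.matrix_mul continuous_const).tendsto _).comp hDA
  have hDAR : Tendsto S.Om2 (𝓝[>] 0) (𝓝 (S.H * S.C * S.A * S.R)) :=
    ((continuous_id.matrix_mul continuous_const).tendsto _).comp hDA
  have hDB : Tendsto S.HCBbar (𝓝[>] 0) (𝓝 (S.H * S.C * S.B)) :=
    ((continuous_const.matrix_mul continuous_id).tendsto S.B).comp S.tendsto_Bbar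
  have hunit : ∀ᶠ T in 𝓝[>] 0, IsUnit (S.HCBbar T) := by
    have h0 : (S.H * S.C * S.B).det ≠ 0 :=
      ((Matrix.isUnit_iff_isUnit_det _).mp hS.isUnit_HCB).ne_zero
    have hdet : Tendsto (fun T => (S.HCBbar T).det) (𝓝[>] 0) (𝓝 (S.H * S.C * S.B).det) :=
      ((continuous_id.matrix_det).tendsto _).comp hDB
    filter_upwards [hdet.eventually_ne h0] with T hT
    exact (Matrix.isUnit_iff_isUnit_det _).mpr (isUnit_iff_ne_zero.mpr hT)
  have hinv : Tendsto (fun T => (S.HCBbar T)⁻¹) (𝓝[>] 0) (𝓝 (S.H * S.C * S.B)⁻¹) := by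
    simp only [Matrix.nonsing_inv_eq_ringInverse]
    have := NormedRing.inverse_continuousAt hS.isUnit_HCB.unit
    exact Tendsto.comp this hDB
  have hcontract : ∀ᶠ T in 𝓝[>] (0 : ℝ),
      ∀ v, N (v + T • (S.M * S.Abar T * S.Q) *ᵥ v) ≤ (1 - c / 2 * T) * N v := by
    have h0 : Tendsto (fun T => ‖S.M * S.Abar T * S.Q - S.Ac‖) (𝓝[>] 0) (𝓝 0) :=
      tendsto_iff_norm_sub_tendsto_zero.mp hMAQ
    have hpos : 0 < c / 2 / L₀ := by positivity
    filter_upwards [h0.eventually_lt_const hpos, Ioc_mem_nhdsGT hτ] with T h1 h2 v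
    rw [lt_div_iff₀ hL₀] at h1
    have h3 : v + T • (S.M * S.Abar T * S.Q) *ᵥ v
        = (v + T • S.Ac *ᵥ v) + T • ((S.M * S.Abar T * S.Q - S.Ac) *ᵥ v) := by
      rw [Matrix.sub_mulVec, smul_sub]
      abel
    have h4 : N ((S.M * S.Abar T * S.Q - S.Ac) *ᵥ v) ≤ c / 2 * N v :=
      calc _ ≤ L₀ * ‖(S.M * S.Abar T * S.Q - S.Ac) *ᵥ v‖ := hN2 _
        _ ≤ L₀ * (‖S.M * S.Abar T * S.Q - S.Ac‖ * ‖v‖) := by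
            gcongr
            exact Matrix.linfty_opNorm_mulVec _ _
        _ = ‖S.M * S.Abar T * S.Q - S.Ac‖ * L₀ * ‖v‖ := by ring
        _ ≤ c / 2 * N v := mul_le_mul h1.le (hN1 v) (norm_nonneg v) (by positivity)
    have h5 := map_add_le_add N (v + T • S.Ac *ᵥ v) (T • ((S.M * S.Abar T * S.Q - S.Ac) *ᵥ v))
    rw [map_smul_eq_mul, Real.norm_of_nonneg h2.1.le] at h5
    have h6 := mul_le_mul_of_nonneg_left h4 h2.1.le
    rw [h3]
    linarith [hN T h2.1.le h2.2 v]
  have hMB : ∀ᶠ L in atTop, ∀ᶠ T in 𝓝[>] 0, ∀ v, ‖(S.M * S.Bbar T) *ᵥ v‖ ≤ L * T * ‖v‖ := by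
    filter_upwards [eventually_ge_atTop (‖S.M‖ * L₁)] with L hL
    filter_upwards [Ioc_mem_nhdsGT hδ₁] with T hT v
    have h1 : S.M * S.Bbar T = S.M * (S.Bbar T - S.B) := by
      rw [Matrix.mul_sub, hM.mul_eq_zero, sub_zero]
    rw [h1]
    refine (Matrix.linfty_opNorm_mulVec _ _).trans ?_
    refine mul_le_mul_of_nonneg_right ?_ (norm_nonneg v)
    have hT0 : 0 ≤ T := hT.1.le
    calc _ ≤ ‖S.M‖ * ‖S.Bbar T - S.B‖ := Matrix.linfty_opNorm_mul _ _
      _ ≤ ‖S.M‖ * (L₁ * T) := by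
          gcongr
          exact hB T hT.1 hT.2
      _ = ‖S.M‖ * L₁ * T := by ring
      _ ≤ L * T := by gcongr
  have hsd : ∀ᶠ L in atTop, ∀ T F V : ℝ, ∀ f k, 0 < T → T ≤ δ₂ → BoundedDisturbance F V f →
      ‖(S.H * S.C) *ᵥ S.dist T f k‖ ≤ L * F * T := by
    filter_upwards [eventually_ge_atTop (‖S.H * S.C‖ * L₂)] with L hL T F V f k hT0 hT hf
    have hF : 0 ≤ F := (norm_nonneg _).trans (hf.bound 0 le_rfl)
    calc _ ≤ ‖S.H * S.C‖ * ‖S.dist T f k‖ := Matrix.linfty_opNorm_mulVec _ _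
      _ ≤ ‖S.H * S.C‖ * (L₂ * F * T) := by
          gcongr
          exact (hd T F V f k hT0 hT hf).1
      _ = ‖S.H * S.C‖ * L₂ * F * T := by ring
      _ ≤ _ := by gcongr
  obtain ⟨L, e1, e2, e3, e4, e5, e6, e7, e8, e9, e10, e11, e12, e13⟩ :=
    ((eventually_mulVec_le hMAR).and <| (eventually_mulVec_le hDAQ).and <|
      (eventually_mulVec_le hDAR).and <| (eventually_mulVec_le hDB).and <|
      (eventually_mulVec_le hinv).and <| hMB.and <| hsd.and <|
      (eventually_mulVec_const_le (S.H * S.C)).and <| (eventually_mulVec_const_le S.M).and <|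
      (eventually_mulVec_const_le S.Q).and <| (eventually_mulVec_const_le S.R).and <|
      (eventually_ge_atTop (max L₀ L₂)).and (eventually_ge_atTop 1)).exists
  have hev : ∀ᶠ T in 𝓝[>] (0 : ℝ), S.StepBounds N (c / 2) L T := by
    filter_upwards [hunit, hcontract, e1, e2, e3, e4, e5, e6, Ioc_mem_nhdsGT hδ₂]
      with T h1 h2 h3 h4 h5 h6 h7 h8 hT
    refine ⟨h1, h2, hN1, fun v => (hN2 v).trans ?_, h3, h4, h5, h6, h7, h8, fun x => ?_, e9, e10,
      e11, fun F V f k hf => ?_, fun F V f k hf => ?_⟩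
    · exact mul_le_mul_of_nonneg_right ((le_max_left _ _).trans e12) (norm_nonneg v)
    · rw [SlidingDesign.slide, Matrix.mulVec_mulVec]; exact e8 x
    · rw [SlidingDesign.slide, Matrix.mulVec_mulVec]; exact e7 T F V f k hT.1 hT.2 hf
    · have hF : 0 ≤ F := (norm_nonneg _).trans (hf.bound 0 le_rfl)
      have hT0 : 0 ≤ T := hT.1.le
      refine (hd T F V f k hT.1 hT.2 hf).2.trans ?_
      gcongr
      exact (le_max_right _ _).trans e12
  obtain ⟨δ, hδ, h⟩ := mem_nhdsGT_iff_exists_Ioc_subset.mp hev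
  exact ⟨N, c / 2, L, δ, by positivity, e13, hδ, fun T h1 h2 => h ⟨h1, h2⟩⟩

end Bounds

/-! ### The closed-loop recursions -/

/-- The input `w[k] = T H C Ā Q ξ[k] + H C d[k]` through which the sliding motion and the
disturbance act on the switching function. -/
noncomputable def drift (T : ℝ) (f : ℝ → Fin m → ℝ) (x : Fin (r + m) → ℝ) (k : ℕ) : Fin m → ℝ :=
  T • (S.H * S.C * S.Abar T * S.Q) *ᵥ S.xi x + S.slide (S.dist T f k)

theorem Phi_eq {T : ℝ} (hT : T ≠ 0) : S.Phi T = 1 + T • S.Abar T := by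
  rw [Abar, smul_smul, mul_one_div_cancel hT, one_smul, add_sub_cancel]

theorem Gam_eq {T : ℝ} (hT : T ≠ 0) : S.Gam T = T • S.Bbar T := by
  rw [Bbar, smul_smul, mul_one_div_cancel hT, one_smul]

variable {S}
variable {T α : ℝ} {f : ℝ → Fin m → ℝ} {x : ℕ → Fin (r + m) → ℝ} {u : ℕ → Fin m → ℝ}

/-- One step of the plant seen through an output matrix `G`, in the coordinates `(ξ, s)`; it is used
for `G = M` and `G = H C`. -/
theorem IsClosedLoop.mulVec_succ (h : S.IsClosedLoop T α f x u) (hP : IsUnit S.P₁.det)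
    (hT : T ≠ 0) {l : ℕ} (G : Matrix (Fin l) (Fin (r + m)) ℝ) (k : ℕ) :
    G *ᵥ x (k + 1) = G *ᵥ x k + T • (G * S.Abar T * S.Q) *ᵥ S.xi (x k)
      + T • (G * S.Abar T * S.R) *ᵥ S.slide (x k) + (G * S.Bbar T) *ᵥ (T • u k)
      + G *ᵥ S.dist T f k := by
  have h1 : (G * S.Abar T) *ᵥ x k = (G * S.Abar T * S.Q) *ᵥ S.xi (x k)
      + (G * S.Abar T * S.R) *ᵥ S.slide (x k) := by
    conv_lhs => rw [S.eq_Q_mulVec_add hP (x k)]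
    simp only [Matrix.mulVec_add, Matrix.mulVec_mulVec]
  rw [h.plant, S.Phi_eq hT, S.Gam_eq hT, Matrix.mulVec_add, Matrix.mulVec_add, Matrix.add_mulVec,
    Matrix.one_mulVec, Matrix.mulVec_add, Matrix.smul_mulVec, Matrix.smul_mulVec,
    Matrix.mulVec_smul, Matrix.mulVec_smul, Matrix.mulVec_mulVec, Matrix.mulVec_mulVec, h1,
    Matrix.mulVec_smul, smul_add]
  abel

theorem IsClosedLoop.slide_succ (h : S.IsClosedLoop T α f x u) (hP : IsUnit S.P₁.det)
    (hT : T ≠ 0) (k : ℕ) :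
    S.slide (x (k + 1)) = S.slide (x k) + T • S.Om2 T *ᵥ S.slide (x k)
      + S.HCBbar T *ᵥ (T • u k) + S.drift T f (x k) k := by
  have hs : ∀ y, (S.H * S.C) *ᵥ y = S.slide y := fun y => by
    rw [slide, Matrix.mulVec_mulVec]
  have h1 := h.mulVec_succ hP hT (S.H * S.C) k
  rw [hs, hs, hs] at h1
  rw [h1, drift, Om2, HCBbar]
  abel

/-- The output feedback makes the switching function follow `s[k+2] = α s[k+1] + w[k+1] - w[k]`. -/
theorem IsClosedLoop.slide_succ_succ (h : S.IsClosedLoop T α f x u) (hP : IsUnit S.P₁.det)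
    (hT : T ≠ 0) (hU : IsUnit (S.HCBbar T)) (k : ℕ) :
    S.slide (x (k + 2)) = α • S.slide (x (k + 1))
      + S.drift T f (x (k + 1)) (k + 1) - S.drift T f (x k) k := by
  have h1 := h.slide_succ hP hT k
  have h2 := h.slide_succ hP hT (k + 1)
  have hdet := (Matrix.isUnit_iff_isUnit_det _).mp hU
  have h3 : S.HCBbar T *ᵥ (T • u (k + 1)) =
      -(((2 - α) • (1 : Matrix (Fin m) (Fin m) ℝ) + T • S.Om2 T) *ᵥ S.slide (x (k + 1))
          - ((1 : Matrix (Fin m) (Fin m) ℝ) + T • S.Om2 T) *ᵥ S.slide (x k))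
        + S.HCBbar T *ᵥ (T • u k) := by
    rw [h.law k, smul_add, smul_neg, smul_smul, mul_one_div_cancel hT, one_smul,
      Matrix.mulVec_add, Matrix.mulVec_neg, Matrix.mulVec_mulVec, Matrix.mul_nonsing_inv _ hdet,
      Matrix.one_mulVec]
  rw [Matrix.add_mulVec, Matrix.add_mulVec, Matrix.smul_mulVec, Matrix.smul_mulVec,
    Matrix.smul_mulVec, Matrix.one_mulVec, Matrix.one_mulVec] at h3
  have h4 : S.HCBbar T *ᵥ (T • u k) = S.slide (x (k + 1)) - S.slide (x k)
      - T • S.Om2 T *ᵥ S.slide (x k) - S.drift T f (x k) k := by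
    rw [h1]; abel
  rw [h2, h3, h4, sub_smul, two_smul]
  abel

variable {N : Seminorm ℝ (Fin r → ℝ)} {c L F V : ℝ}

theorem StepBounds.norm_drift_le (hb : S.StepBounds N c L T) (hL : 1 ≤ L) (hT : 0 < T)
    (hf : BoundedDisturbance F V f) (y : Fin (r + m) → ℝ) (k : ℕ) :
    ‖S.drift T f y k‖ ≤ T * L * N (S.xi y) + T * (L * F) := by
  have h1 := hb.HCAQ (S.xi y)
  have h2 := mul_le_mul_of_nonneg_left (hb.norm_le (S.xi y)) (by linarith : 0 ≤ L)
  have h3 := hb.slide_dist F V f k hf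
  refine (norm_add_le _ _).trans ?_
  rw [norm_smul, Real.norm_of_nonneg hT.le]
  have h4 := mul_le_mul_of_nonneg_left (h1.trans h2) hT.le
  linarith

/-- `ξ` contracts up to terms of order `T` in `s` and of order `T²` in the disturbance: the input
is eliminated through the equation for `s`, and enters `ξ` with the small factor `M B̄ = O(T)`. -/
theorem StepBounds.xi_succ_le (hb : S.StepBounds N c L T) (hL : 1 ≤ L) (hT : 0 < T)
    (hTL : T * L ≤ 1) (hTc : T * L ^ 4 ≤ c / 2) (hP : IsUnit S.P₁.det)
    (h : S.IsClosedLoop T α f x u) (hf : BoundedDisturbance F V f) (k : ℕ) :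
    N (S.xi (x (k + 1))) ≤ (1 - c / 2 * T) * N (S.xi (x k))
      + T * ((L ^ 2 + 2 * L ^ 3) * (‖S.slide (x (k + 1))‖ + ‖S.slide (x k)‖))
      + T * (T * ((L ^ 4 + L ^ 2) * F)) := by
  have hL0 : 0 ≤ L := by linarith
  have hN0 : 0 ≤ N (S.xi (x k)) := apply_nonneg N _
  set s := S.slide (x k) with hs
  set s' := S.slide (x (k + 1)) with hs'
  have hu : ‖T • u k‖ ≤ L * (‖s'‖ + 2 * ‖s‖ + T * L * N (S.xi (x k)) + T * (L * F)) := by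
    have h1 : T • u k = (S.HCBbar T)⁻¹ *ᵥ (s' - s - T • S.Om2 T *ᵥ s - S.drift T f (x k) k) := by
      have hdet := (Matrix.isUnit_iff_isUnit_det _).mp hb.isUnit
      have h2 := h.slide_succ hP hT.ne' k
      have h3 : s' - s - T • S.Om2 T *ᵥ s - S.drift T f (x k) k = S.HCBbar T *ᵥ (T • u k) := by
        rw [hs', h2]; abel
      rw [h3, Matrix.mulVec_mulVec, Matrix.nonsing_inv_mul _ hdet, Matrix.one_mulVec]
    rw [h1]
    refine (hb.HCBbar_inv _).trans (mul_le_mul_of_nonneg_left ?_ hL0)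
    have h4 := norm_sub_le (s' - s - T • S.Om2 T *ᵥ s) (S.drift T f (x k) k)
    have h5 := norm_sub_le (s' - s) (T • S.Om2 T *ᵥ s)
    have h6 := norm_sub_le s' s
    have h7 : ‖T • S.Om2 T *ᵥ s‖ ≤ ‖s‖ := by
      rw [norm_smul, Real.norm_of_nonneg hT.le]
      have h8 := mul_le_mul_of_nonneg_left (hb.Om2 s) hT.le
      have h9 := mul_le_mul_of_nonneg_right hTL (norm_nonneg s)
      linarith
    linarith [hb.norm_drift_le hL hT hf (x k) k]
  have e1 : S.xi (x (k + 1)) = ((S.xi (x k) + T • (S.M * S.Abar T * S.Q) *ᵥ S.xi (x k))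
      + T • (S.M * S.Abar T * S.R) *ᵥ s + (S.M * S.Bbar T) *ᵥ (T • u k))
      + S.xi (S.dist T f k) := h.mulVec_succ hP hT.ne' S.M k
  have n1 : N (T • (S.M * S.Abar T * S.R) *ᵥ s) ≤ T * (L * (L * ‖s‖)) := by
    rw [map_smul_eq_mul, Real.norm_of_nonneg hT.le]
    gcongr
    exact (hb.le_norm _).trans (mul_le_mul_of_nonneg_left (hb.MAR _) hL0)
  have n2 : N ((S.M * S.Bbar T) *ᵥ (T • u k)) ≤
      L * (L * T * (L * (‖s'‖ + 2 * ‖s‖ + T * L * N (S.xi (x k)) + T * (L * F)))) := by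
    refine (hb.le_norm _).trans (mul_le_mul_of_nonneg_left ((hb.MBbar _).trans ?_) hL0)
    gcongr
  have n3 : N (S.xi (S.dist T f k)) ≤ L * (L * F * T * T) :=
    (hb.le_norm _).trans (mul_le_mul_of_nonneg_left (hb.xi_dist F V f k hf) hL0)
  have t1 := map_add_le_add N ((S.xi (x k) + T • (S.M * S.Abar T * S.Q) *ᵥ S.xi (x k))
      + T • (S.M * S.Abar T * S.R) *ᵥ s + (S.M * S.Bbar T) *ᵥ (T • u k)) (S.xi (S.dist T f k))
  have t2 := map_add_le_add N ((S.xi (x k) + T • (S.M * S.Abar T * S.Q) *ᵥ S.xi (x k))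
      + T • (S.M * S.Abar T * S.R) *ᵥ s) ((S.M * S.Bbar T) *ᵥ (T • u k))
  have t3 := map_add_le_add N (S.xi (x k) + T • (S.M * S.Abar T * S.Q) *ᵥ S.xi (x k))
      (T • (S.M * S.Abar T * S.R) *ᵥ s)
  have t4 := hb.contract (S.xi (x k))
  have t5 : T * (T * L ^ 4 * N (S.xi (x k))) ≤ T * (c / 2 * N (S.xi (x k))) := by gcongr
  have t6 : 0 ≤ T * L ^ 2 * ‖s'‖ := by positivity
  have t7 : 0 ≤ T * L ^ 3 * ‖s'‖ := by positivity
  rw [e1]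
  linarith

/-! ### Uniform decay and the control input -/

/-- All closed-loop trajectories decay geometrically to an `O(T)` ball, with constants that do not
depend on `T`, `α` or the disturbance. -/
theorem exists_uniform_decay (hP : IsUnit S.P₁.det) {δ : ℝ} (hc : 0 < c) (hL : 1 ≤ L)
    (hδ : 0 < δ) (hb : ∀ T, 0 < T → T ≤ δ → S.StepBounds N c L T) :
    ∃ W δ' : ℝ, 0 < W ∧ 0 < δ' ∧ δ' ≤ δ ∧ ∀ T α : ℝ, 0 < T → T ≤ δ' → 0 < α → α < 1 →
      ∀ F ρ : ℝ, ∃ l : ℝ, 0 ≤ l ∧ l < 1 ∧ ∀ V f x u, BoundedDisturbance F V f →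
        S.IsClosedLoop T α f x u → ‖S.slide (x 0)‖ ≤ ρ → ‖S.xi (x 0)‖ ≤ ρ → ‖u 0‖ ≤ ρ →
        ∀ k, N (S.xi (x k)) ≤ W * (l ^ k * |ρ| + |F| * T) ∧
          ‖S.slide (x k)‖ ≤ W * (l ^ k * |ρ| + |F| * T) := by
  have hL0 : 0 < L := by linarith
  have hc2 : 0 < c / 2 := by positivity
  set e := L ^ 2 + 2 * L ^ 3 with he
  have he0 : 0 < e := by positivity
  have hLe : L ≤ e := by nlinarith [pow_pos hL0 3]
  obtain ⟨a, ha, hdec⟩ := scalar_decay hc2 he0.le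
  -- `T D ≤ 1` implies all the smallness conditions on `T`, one for each summand
  set D := L + 2 / c * L ^ 4 + 4 / a * e + c / 2 with hD
  have hD0 : 0 < D := by positivity
  set G := L ^ 4 + L ^ 2 + L with hG
  have hG0 : 0 < G := by positivity
  set W₀ := L + 4 / a + 4 / a * G with hW₀
  have hW₀0 : 0 < W₀ := by positivity
  refine ⟨(1 + 5 * a) * W₀, min δ (1 / D), by positivity, by positivity, min_le_left _ _,
    fun T α hT hTδ hα0 hα1 F ρ => ?_⟩
  have hTD : T * D ≤ 1 := by
    have := hTδ.trans (min_le_right _ _)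
    rwa [le_div_iff₀ hD0] at this
  have hsplit : ∀ y, y ≤ D → T * y ≤ 1 := fun y hy =>
    (mul_le_mul_of_nonneg_left hy hT.le).trans hTD
  have p1 : 0 ≤ 2 / c * L ^ 4 := by positivity
  have p2 : 0 ≤ 4 / a * e := by positivity
  have hTL : T * L ≤ 1 := hsplit _ (by linarith)
  have hTc : T * L ^ 4 ≤ c / 2 := by
    have h1 : T * (2 / c * L ^ 4) ≤ 1 := hsplit _ (by linarith)
    have h2 : T * (2 / c * L ^ 4) = T * L ^ 4 / (c / 2) := by field_simp
    rwa [h2, div_le_one hc2] at h1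
  have hTa : 4 * (T * e) ≤ a := by
    have h1 : T * (4 / a * e) ≤ 1 := hsplit _ (by linarith)
    have h2 : T * (4 / a * e) = 4 * (T * e) / a := by field_simp
    rwa [h2, div_le_one ha] at h1
  have hTc' : c / 2 * T ≤ 1 := by
    have := hsplit (c / 2) (by linarith)
    linarith
  have hB := hb T hT (hTδ.trans (min_le_left _ _))
  have hgK : 4 * (G * |F|) ≤ a * (4 / a * (G * |F|)) := by
    apply le_of_eq; field_simp
  have hX0 : 0 ≤ (L + 4 / a) * |ρ| := by positivity
  obtain ⟨l, hl0, hl1, hl⟩ := hdec (G * |F|) (4 / a * (G * |F|)) T α ((L + 4 / a) * |ρ|)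
    (by positivity) hgK hT hTa hTc' hα0 hα1 hX0
  refine ⟨l, hl0, hl1, fun V f x u hf hcl hs0 hx0 hu0 k => ?_⟩
  have hF : 0 ≤ F := (norm_nonneg _).trans (hf.bound 0 le_rfl)
  have hρ : 0 ≤ ρ := (norm_nonneg _).trans hu0
  rw [abs_of_nonneg hρ, abs_of_nonneg hF] at *
  have hdrift : ∀ k, ‖S.drift T f (x k) k‖ ≤ T * e * N (S.xi (x k)) + T * (G * F) := fun k => by
    have h1 : T * L * N (S.xi (x k)) ≤ T * e * N (S.xi (x k)) :=
      mul_le_mul_of_nonneg_right (mul_le_mul_of_nonneg_left hLe hT.le) (apply_nonneg N _)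
    have h2 : T * (L * F) ≤ T * (G * F) := by
      gcongr
      rw [hG]
      have : 0 ≤ L ^ 4 + L ^ 2 := by positivity
      linarith
    linarith [hB.norm_drift_le hL hT hf (x k) k]
  have haX : a * ((L + 4 / a) * ρ) = a * L * ρ + 4 * ρ := by field_simp
  have haL : 0 ≤ a * L * ρ := by positivity
  have hfin := hl (fun k => N (S.xi (x k))) (fun k => ‖S.slide (x (k + 1)) - S.drift T f (x k) k‖)
    (fun k => ‖S.slide (x k)‖)
    (by
      have h1 := (hB.le_norm (S.xi (x 0))).trans (mul_le_mul_of_nonneg_left hx0 hL0.le)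
      have : 0 ≤ 4 / a * ρ := by positivity
      linarith)
    (by
      have h1 : S.slide (x (0 + 1)) - S.drift T f (x 0) 0 = S.slide (x 0)
          + T • S.Om2 T *ᵥ S.slide (x 0) + T • S.HCBbar T *ᵥ u 0 := by
        rw [hcl.slide_succ hP hT.ne' 0, Matrix.mulVec_smul, add_sub_cancel_right]
      have h2 : ∀ v w : Fin m → ℝ, ‖w‖ ≤ L * ‖v‖ → ‖v‖ ≤ ρ → ‖T • w‖ ≤ ρ := fun v w hw hv => by
        rw [norm_smul, Real.norm_of_nonneg hT.le]
        have h3 := mul_le_mul_of_nonneg_left hw hT.le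
        have h4 := mul_le_mul_of_nonneg_right hTL (norm_nonneg v)
        linarith
      have h3 := h2 _ _ (hB.Om2 (S.slide (x 0))) hs0
      have h4 := h2 _ _ (hB.HCBbar (u 0)) hu0
      simp only [h1]
      refine (norm_add₃_le).trans ?_
      linarith)
    (by linarith)
    (fun k => by
      have h1 := hB.xi_succ_le hL hT hTL hTc hP hcl hf k
      have h2 : T * (T * ((L ^ 4 + L ^ 2) * F)) ≤ T * (T * (G * F)) := by
        gcongr
        linarith
      linarith)
    (fun k => by
      have h1 := norm_add_le (S.slide (x (k + 1)) - S.drift T f (x k) k) (S.drift T f (x k) k)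
      rw [sub_add_cancel] at h1
      linarith [hdrift k])
    (fun k => by
      have h1 : S.slide (x (k + 1 + 1)) - S.drift T f (x (k + 1)) (k + 1)
          = α • (S.slide (x (k + 1)) - S.drift T f (x k) k)
            - (1 - α) • S.drift T f (x k) k := by
        rw [hcl.slide_succ_succ hP hT.ne' hB.isUnit k, smul_sub, sub_smul, one_smul]
        abel
      simp only [h1]
      refine (norm_sub_le _ _).trans ?_
      rw [norm_smul, norm_smul, Real.norm_of_nonneg hα0.le,
        Real.norm_of_nonneg (by linarith : 0 ≤ 1 - α)]
      have := mul_le_mul_of_nonneg_left (hdrift k) (by linarith : 0 ≤ 1 - α)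
      linarith) k
  have hlk : 0 ≤ l ^ k * ρ := by positivity
  have hFT : 0 ≤ F * T := by positivity
  have hE : l ^ k * ((L + 4 / a) * ρ) + 4 / a * (G * F) * T ≤ W₀ * (l ^ k * ρ + F * T) := by
    have h1 : 0 ≤ 4 / a * G * (l ^ k * ρ) := by positivity
    have h2 : 0 ≤ (L + 4 / a) * (F * T) := by positivity
    rw [hW₀]
    linarith
  have hW1 : 0 ≤ W₀ * (l ^ k * ρ + F * T) := by positivity
  have hW2 : 0 ≤ a * (W₀ * (l ^ k * ρ + F * T)) := by positivity
  have hE5 := mul_le_mul_of_nonneg_left hE (by positivity : 0 ≤ 5 * a)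
  exact ⟨by linarith [hfin.1], by linarith [hfin.2]⟩

/-- The input is recovered from `s[k+2] - s[k+1] = O(T)`, which is where `1 - α = O(T)` enters. -/
theorem StepBounds.norm_input_succ_le (hb : S.StepBounds N c L T) (hL : 1 ≤ L) (hT : 0 < T)
    (hP : IsUnit S.P₁.det) (h : S.IsClosedLoop T α f x u) (hf : BoundedDisturbance F V f)
    {β Y : ℝ} (hα1 : α < 1) (hβ : (1 - α) / T ≤ β)
    (k : ℕ) (hz : N (S.xi (x k)) ≤ Y) (hs : ‖S.slide (x (k + 1))‖ ≤ Y) :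
    ‖u (k + 1)‖ ≤ L * (β * Y + 2 * L * Y + L * F) := by
  have hL0 : 0 ≤ L := by linarith
  have hβ' : 1 - α ≤ β * T := (div_le_iff₀ hT).mp hβ
  have hdet := (Matrix.isUnit_iff_isUnit_det _).mp hb.isUnit
  have h1 : S.HCBbar T *ᵥ (T • u (k + 1)) = -((1 - α) • S.slide (x (k + 1)))
      - T • S.Om2 T *ᵥ S.slide (x (k + 1)) - S.drift T f (x k) k := by
    have h2 := h.slide_succ hP hT.ne' (k + 1)
    rw [h.slide_succ_succ hP hT.ne' hb.isUnit k] at h2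
    rw [sub_smul, one_smul]
    linear_combination -h2
  have h2 : T • u (k + 1) = (S.HCBbar T)⁻¹ *ᵥ (-((1 - α) • S.slide (x (k + 1)))
      - T • S.Om2 T *ᵥ S.slide (x (k + 1)) - S.drift T f (x k) k) := by
    rw [← h1, Matrix.mulVec_mulVec, Matrix.nonsing_inv_mul _ hdet, Matrix.one_mulVec]
  have hY : 0 ≤ Y := (norm_nonneg _).trans hs
  have h3 : ‖T • u (k + 1)‖ ≤ L * (T * (β * Y + 2 * L * Y + L * F)) := by
    rw [h2]
    refine (hb.HCBbar_inv _).trans (mul_le_mul_of_nonneg_left ?_ hL0)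
    have t1 := norm_sub_le (-((1 - α) • S.slide (x (k + 1)))
      - T • S.Om2 T *ᵥ S.slide (x (k + 1))) (S.drift T f (x k) k)
    have t2 := norm_sub_le (-((1 - α) • S.slide (x (k + 1))))
      (T • S.Om2 T *ᵥ S.slide (x (k + 1)))
    have t3 : ‖-((1 - α) • S.slide (x (k + 1)))‖ ≤ β * T * Y := by
      rw [norm_neg, norm_smul, Real.norm_of_nonneg (by linarith)]
      exact mul_le_mul hβ' hs (norm_nonneg _) (by linarith)
    have t4 : ‖T • S.Om2 T *ᵥ S.slide (x (k + 1))‖ ≤ T * (L * Y) := by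
      rw [norm_smul, Real.norm_of_nonneg hT.le]
      gcongr
      exact (hb.Om2 _).trans (mul_le_mul_of_nonneg_left hs hL0)
    have t5 := hb.norm_drift_le hL hT hf (x k) k
    have t6 : T * L * N (S.xi (x k)) ≤ T * L * Y := by gcongr
    linarith
  rw [norm_smul, Real.norm_of_nonneg hT.le] at h3
  refine le_of_mul_le_mul_left ?_ hT
  linarith

end SlidingDesign
theorem theorem2 {r m p : ℕ} (_hmp : m ≤ p) (_hpn : p < r + m)
    (S : SlidingDesign r m p) (_hM : S.IsAnnihilator) (_hS : S.IsLegitimate) (βmax : ℝ) :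
    ∃ Tstar : ℝ, 0 < Tstar ∧
      -- the control law is well defined
      (∀ T : ℝ, 0 < T → T ≤ Tstar → IsUnit (S.HCBbar T)) ∧
      ∀ F V : ℝ,
        -- quasi-sliding motion in an `O(T)` boundary layer, `O(T)` ultimate bound on the state
        (∃ K : ℝ, 0 < K ∧ ∀ T α : ℝ, 0 < T → T ≤ Tstar → 0 < α → α < 1 →
          (1 - α) / T ≤ βmax → ∀ ρ : ℝ, ∃ N : ℕ,
            ∀ (f : ℝ → Fin m → ℝ) (x : ℕ → Fin (r + m) → ℝ) (u : ℕ → Fin m → ℝ),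
              BoundedDisturbance F V f → S.IsClosedLoop T α f x u →
              ‖x 0‖ ≤ ρ → ‖u 0‖ ≤ ρ →
              ∀ k : ℕ, N ≤ k → ‖S.slide (x k)‖ ≤ K * T ∧ ‖x k‖ ≤ K * T) ∧
        -- the control input is `O(1)` at all times
        (∀ ρ : ℝ, ∃ K : ℝ, 0 < K ∧ ∀ T α : ℝ, 0 < T → T ≤ Tstar → 0 < α → α < 1 →
          (1 - α) / T ≤ βmax →
            ∀ (f : ℝ → Fin m → ℝ) (x : ℕ → Fin (r + m) → ℝ) (u : ℕ → Fin m → ℝ),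
              BoundedDisturbance F V f → S.IsClosedLoop T α f x u →
              ‖S.slide (x 0)‖ ≤ ρ → ‖S.xi (x 0)‖ ≤ ρ → ‖u 0‖ ≤ ρ →
              ∀ k : ℕ, ‖u k‖ ≤ K) := by

  -- Gelfand's formula is applied in a nontrivial matrix algebra; `m ≤ p < r + m` gives `r ≠ 0`
  have hr : NeZero r := ⟨by omega⟩
  have hP := S.isUnit_det_P₁ _hM _hS.isUnit_HCB
  obtain ⟨N, c, L, δ, hc, hL, hδ, hb⟩ := S.exists_stepBounds _hM _hS
  obtain ⟨W, δ', hW, hδ', hδδ, hdec⟩ := SlidingDesign.exists_uniform_decay hP hc hL hδ hb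
  have hL0 : 0 < L := by linarith
  refine ⟨δ', hδ', fun T hT hTδ => (hb T hT (hTδ.trans hδδ)).isUnit, fun F V => ⟨?_, fun ρ => ?_⟩⟩
  · refine ⟨2 * L * (W * (1 + |F|)), by positivity, fun T α hT hTδ hα0 hα1 _ ρ => ?_⟩
    have hB := hb T hT (hTδ.trans hδδ)
    obtain ⟨l, hl0, hl1, hl⟩ := hdec T α hT hTδ hα0 hα1 F (L * ρ)
    have hlim : Tendsto (fun k : ℕ => l ^ k * |L * ρ|) atTop (𝓝 0) := by
      simpa using (tendsto_pow_atTop_nhds_zero_of_lt_one hl0 hl1).mul_const |L * ρ|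
    obtain ⟨n, hn⟩ := eventually_atTop.mp (hlim.eventually_le_const hT)
    refine ⟨n, fun f x u hf hcl hx0 hu0 k hk => ?_⟩
    have hρ : 0 ≤ ρ := (norm_nonneg _).trans hu0
    have hLρ : ρ ≤ L * ρ := le_mul_of_one_le_left hρ hL
    have hx0' := mul_le_mul_of_nonneg_left hx0 hL0.le
    obtain ⟨h1, h2⟩ := hl V f x u hf hcl ((hB.slide _).trans hx0') ((hB.xi _).trans hx0')
      (hu0.trans hLρ) k
    have h3 : W * (l ^ k * |L * ρ| + |F| * T) ≤ W * (1 + |F|) * T := by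
      have := mul_le_mul_of_nonneg_left (hn k hk) hW.le
      linarith
    have h4 : 0 ≤ W * (1 + |F|) * T := by positivity
    have h5 : W * (1 + |F|) * T ≤ L * (W * (1 + |F|) * T) := le_mul_of_one_le_left h4 hL
    refine ⟨by linarith, ?_⟩
    have h6 := (hB.Q (S.xi (x k))).trans
      (mul_le_mul_of_nonneg_left ((hB.norm_le _).trans (h1.trans h3)) hL0.le)
    have h7 := (hB.R (S.slide (x k))).trans (mul_le_mul_of_nonneg_left (h2.trans h3) hL0.le)
    rw [S.eq_Q_mulVec_add hP (x k)]
    refine (norm_add_le _ _).trans ?_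
    linarith
  · set Y := W * (|ρ| + |F| * δ') with hY
    have hY0 : 0 ≤ Y := by positivity
    have hK0 : 0 ≤ L * (|βmax| * Y + 2 * L * Y + L * |F|) := by positivity
    refine ⟨|ρ| + L * (|βmax| * Y + 2 * L * Y + L * |F|) + 1, by positivity,
      fun T α hT hTδ hα0 hα1 hβ f x u hf hcl hs0 hx0 hu0 k => ?_⟩
    obtain ⟨l, hl0, hl1, hl⟩ := hdec T α hT hTδ hα0 hα1 F ρ
    have hle : ∀ k, W * (l ^ k * |ρ| + |F| * T) ≤ Y := fun k => by
      have h1 : l ^ k * |ρ| ≤ |ρ| :=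
        mul_le_of_le_one_left (abs_nonneg ρ) (pow_le_one₀ hl0 hl1.le)
      rw [hY]
      gcongr
    have htraj := hl V f x u hf hcl hs0 hx0 hu0
    cases k with
    | zero => linarith [le_abs_self ρ]
    | succ k =>
      have h1 := (hb T hT (hTδ.trans hδδ)).norm_input_succ_le hL hT hP hcl hf hα1
        (hβ.trans (le_abs_self βmax)) k ((htraj k).1.trans (hle k))
        ((htraj (k + 1)).2.trans (hle (k + 1)))
      have h2 : L * (L * F) ≤ L * (L * |F|) := by
        gcongr
        exact le_abs_self F
      linarith [abs_nonneg ρ]
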